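/- Let $n\ge 0$ and let $\mathbb{S}^n\subset\mathbb{R}^{n+1}$ be the unit sphere. A (convex) spherical polytope is the intersection of $\mathbb{S}^n$ with finitely many closed halfspaces of the form $\{y : \langle c,y\rangle\ge 0\}$, $c\neq 0$. A polytope is of B-type if it contains two antipodal points $y,-y$ of $\mathbb{S}^n$, and of A-type otherwise. A face of a polytope $P$ is a set $\{y\in P:\langle c,y\rangle=0\}$, where $c\in\mathbb{R}^{n+1}$ satisfies $\langle c,y\rangle\ge 0$ for all $y\in P$; a point $x$ is a vertex of $P$ if $x$ lies in a face of $P$ that is contained in $\{x,-x\}$ (for an A-type polytope this means that $\{x\}$ is a face). A locally finite tiling of $\mathbb{S}^n$ by polytopes is a set of spherical polytopes with non-empty interior in $\mathbb{S}^n$ whose union is $\mathbb{S}^n$, whose interiors are pairwise disjoint, and such that every bounded subset of $\mathbb{S}^n$ meets only finitely many of them. **Theorem.** Suppose that a locally finite tiling of $\mathbb{S}^n$ by polytopes contains exactly two A-type polytopes $P\ne P'$, and let $x$ be a vertex of $P$. Then exactly one of the points $x$ and $-x$ is a vertex of $P'$. -/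

import Mathlib

open scoped RealInnerProductSpace

/-- The unit sphere `S^n`, as the subspace of unit vectors of `ℝ^(n+1)`. -/
abbrev UnitSphere (n : ℕ) : Type :=
  Metric.sphere (0 : EuclideanSpace ℝ (Fin (n + 1))) 1

namespace UnitSphere

variable {n : ℕ}

/-- A (convex) spherical polytope: the intersection of the sphere with finitely many closed
halfspaces `{y | 0 ≤ ⟪c, y⟫}`, `c ≠ 0`, bounded by hyperplanes through the centre. -/
def IsPolytope (P : Set (UnitSphere n)) : Prop :=
  ∃ s : Finset (EuclideanSpace ℝ (Fin (n + 1))),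
    (∀ c ∈ s, c ≠ 0) ∧
      P = {y : UnitSphere n | ∀ c ∈ s, 0 ≤ ⟪c, (y : EuclideanSpace ℝ (Fin (n + 1)))⟫}

/-- A locally finite tiling of the sphere by (`n`-dimensional) spherical polytopes. Interiors are
taken in the sphere, and nonempty interior expresses that a tile is `n`-dimensional. -/
structure IsLocallyFiniteTiling (T : Set (Set (UnitSphere n))) : Prop where
  isPolytope : ∀ P ∈ T, IsPolytope P
  interior_nonempty : ∀ P ∈ T, (interior P).Nonempty
  covering : ⋃₀ T = Set.univ
  packing : ∀ P ∈ T, ∀ Q ∈ T, P ≠ Q → Disjoint (interior P) (interior Q)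
  locallyFinite : ∀ U : Set (UnitSphere n), Bornology.IsBounded U →
    {P ∈ T | (P ∩ U).Nonempty}.Finite

/-- A polytope is of B-type if it contains the two ends of some diameter of the sphere. -/
def IsBType (P : Set (UnitSphere n)) : Prop :=
  ∃ y : UnitSphere n, y ∈ P ∧ -y ∈ P

/-- A polytope is of A-type if it is not of B-type. -/
def IsAType (P : Set (UnitSphere n)) : Prop :=
  ¬ IsBType P

/-- `F` is a face of `P`: the part of `P` on which a linear inequality that is valid on `P`
holds with equality. -/
def IsFace (F P : Set (UnitSphere n)) : Prop :=
  ∃ c : EuclideanSpace ℝ (Fin (n + 1)),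
    (∀ y ∈ P, 0 ≤ ⟪c, (y : EuclideanSpace ℝ (Fin (n + 1)))⟫) ∧
      F = {y ∈ P | ⟪c, (y : EuclideanSpace ℝ (Fin (n + 1)))⟫ = 0}

/-- `x` is a vertex of `P`: it lies in a face of dimension zero, that is, in a face which spans
only the line through `x` and hence is contained in `{x, -x}`. For an A-type polytope, such a face
is the single point `x`. -/
def IsVertex (x : UnitSphere n) (P : Set (UnitSphere n)) : Prop :=
  ∃ F : Set (UnitSphere n), IsFace F P ∧ x ∈ F ∧ F ⊆ {x, -x}

end UnitSphere

/-! The proof is a parity count. From a complete flag of faces of `P` beginning at the vertex `x`,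
build a basis `v` with `v 0 = x`. For each of the `2 ^ (n + 1)` sign vectors `ε`, the curve `∑ δ ^ j
• ε j • v j` lies, for small `δ > 0`, in the cone over exactly one tile, so the sign vectors are
distributed among the tiles (`sum_card_lexPos`).

A constraint `c` sees only the sign at its leading index. If no constraint of a tile leads at `k`,
flipping `ε k` pairs up its sign vectors, and their number is even (`even_card_filter_lexPos`). If
every index leads, the constraints contain a basis and the tile is of A-type
(`isAType_of_isLeading`). By the choice of the flag, `P` receives only the all-ones vector. The
total is even, so some other tile has an odd count; it is of A-type, hence it is `P'`.

So every index leads for `P'`. The constraints leading at positive indices cut out the line through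
`x`, and the sign `ε 0` of any sign vector of `P'` tells which of `x`, `-x` lies in `P'`
(`isVertex_of_isLeading`). Both cannot, since `P'` is of A-type. -/

/-! ### Lexicographic sign patterns and germs of curves. -/

section LexicographicSigns

variable {E : Type*} [NormedAddCommGroup E] [InnerProductSpace ℝ E]

/-- The first nonzero number among the `⟪c, v k⟫` exists and has the sign `ε k`. -/
def LexPos {m : ℕ} (v : Fin m → E) (ε : Fin m → ℤˣ) (c : E) : Prop :=
  ∃ k, (∀ j < k, ⟪c, v j⟫ = 0) ∧ 0 < ((ε k : ℤ) : ℝ) * ⟪c, v k⟫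

/-- The index `k` is the first one with `⟪c, v k⟫ ≠ 0`. -/
def IsLeading {m : ℕ} (v : Fin m → E) (c : E) (k : Fin m) : Prop :=
  (∀ j < k, ⟪c, v j⟫ = 0) ∧ ⟪c, v k⟫ ≠ 0

theorem IsLeading.unique {m : ℕ} {v : Fin m → E} {c : E} {k l : Fin m}
    (hk : IsLeading v c k) (hl : IsLeading v c l) : k = l := by
  rcases lt_trichotomy k l with h | h | h
  · exact absurd (hl.1 k h) hk.2
  · exact h
  · exact absurd (hk.1 l h) hl.2

theorem exists_isLeading {m : ℕ} {v : Fin m → E} {c : E} (h : ∃ k, ⟪c, v k⟫ ≠ 0) :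
    ∃ k, IsLeading v c k := by
  classical
  obtain ⟨k, hk, hmin⟩ := WellFounded.has_min (wellFounded_lt (α := Fin m))
    {k | ⟪c, v k⟫ ≠ 0} h
  exact ⟨k, fun j hj => by_contra fun hne => hmin j hne hj, hk⟩

theorem LexPos.isLeading {m : ℕ} {v : Fin m → E} {ε : Fin m → ℤˣ} {c : E} (h : LexPos v ε c) :
    ∃ k, IsLeading v c k ∧ 0 < ((ε k : ℤ) : ℝ) * ⟪c, v k⟫ := by
  obtain ⟨k, h0, hk⟩ := h
  exact ⟨k, ⟨h0, fun h => by simp [h] at hk⟩, hk⟩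

theorem IsLeading.lexPos_or_neg {m : ℕ} {v : Fin m → E} {c : E} {k : Fin m}
    (hk : IsLeading v c k) (ε : Fin m → ℤˣ) : LexPos v ε c ∨ LexPos v ε (-c) := by
  have hne : ((ε k : ℤ) : ℝ) * ⟪c, v k⟫ ≠ 0 := mul_ne_zero (by simp) hk.2
  rcases hne.lt_or_gt with h | h
  · refine Or.inr ⟨k, fun j hj => by simp [hk.1 j hj], ?_⟩
    rw [inner_neg_left]
    linarith
  · exact Or.inl ⟨k, hk.1, h⟩

theorem LexPos.flip {m : ℕ} {v : Fin m → E} {ε : Fin m → ℤˣ} {c : E} {k : Fin m}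
    (h : LexPos v ε c) (hk : ¬ IsLeading v c k) :
    LexPos v (Function.update ε k (-ε k)) c := by
  obtain ⟨l, hl, hpos⟩ := h.isLeading
  refine ⟨l, hl.1, ?_⟩
  have : l ≠ k := fun e => hk (e ▸ hl)
  rwa [Function.update_of_ne this]

/-- Near zero a polynomial has the sign of its lowest nonzero coefficient. -/
theorem eventually_sum_pow_mul_pos {m : ℕ} {a : Fin m → ℝ} {k : Fin m}
    (h0 : ∀ j < k, a j = 0) (hk : 0 < a k) :
    ∀ᶠ δ in nhdsWithin (0 : ℝ) (Set.Ioi 0), 0 < ∑ j : Fin m, δ ^ (j : ℕ) * a j := by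
  -- The factor `δ ^ k` is taken out. Truncated subtraction is harmless, as `a j = 0` for `j < k`.
  have hcont : Continuous fun δ : ℝ => ∑ j : Fin m, δ ^ ((j : ℕ) - (k : ℕ)) * a j := by fun_prop
  have hval : ∑ j : Fin m, (0 : ℝ) ^ ((j : ℕ) - (k : ℕ)) * a j = a k := by
    rw [Finset.sum_eq_single k]
    · simp
    · intro j _ hj
      rcases lt_or_gt_of_ne hj with h | h
      · simp [h0 j h]
      · rw [zero_pow (by have : (k : ℕ) < j := h
                         omega), zero_mul]
    · simp
  have hev : ∀ᶠ δ in nhds (0 : ℝ), 0 < ∑ j : Fin m, δ ^ ((j : ℕ) - (k : ℕ)) * a j :=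
    hcont.continuousAt.eventually (lt_mem_nhds (hk.trans_eq hval.symm))
  filter_upwards [nhdsWithin_le_nhds hev, self_mem_nhdsWithin] with δ hδ hpos
  have hsum : ∑ j : Fin m, δ ^ (j : ℕ) * a j
      = δ ^ (k : ℕ) * ∑ j : Fin m, δ ^ ((j : ℕ) - (k : ℕ)) * a j := by
    rw [Finset.mul_sum]
    refine Finset.sum_congr rfl fun j _ => ?_
    rcases lt_or_ge j k with h | h
    · simp [h0 j h]
    · rw [← mul_assoc, ← pow_add, Nat.add_sub_cancel' h]
  rw [hsum]
  exact mul_pos (pow_pos hpos _) hδ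

/-- A curve through the origin whose germ lies in the lexicographic orthant of signs `ε`. -/
noncomputable def lexCurve {m : ℕ} (v : Fin m → E) (ε : Fin m → ℤˣ) (δ : ℝ) : E :=
  ∑ j : Fin m, δ ^ (j : ℕ) • ((ε j : ℤ) : ℝ) • v j

theorem LexPos.eventually_inner_lexCurve_pos {m : ℕ} {v : Fin m → E} {ε : Fin m → ℤˣ} {c : E}
    (h : LexPos v ε c) :
    ∀ᶠ δ in nhdsWithin (0 : ℝ) (Set.Ioi 0), 0 < ⟪c, lexCurve v ε δ⟫ := by
  obtain ⟨k, h0, hk⟩ := h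
  have := eventually_sum_pow_mul_pos (a := fun j => ((ε j : ℤ) : ℝ) * ⟪c, v j⟫) (k := k)
    (fun j hj => by simp [h0 j hj]) hk
  simpa only [lexCurve, inner_sum, real_inner_smul_right] using this

/-- Flipping the sign at `k` affects no constraint and is an involution without fixed points. -/
theorem even_card_filter_lexPos {m : ℕ} {v : Fin m → E} {s : Finset E} {k : Fin m}
    (hk : ∀ c ∈ s, ¬ IsLeading v c k) [DecidablePred fun ε => ∀ c ∈ s, LexPos v ε c] :
    Even (Finset.univ.filter fun ε : Fin m → ℤˣ => ∀ c ∈ s, LexPos v ε c).card := by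
  rw [← ZMod.natCast_eq_zero_iff_even, Finset.card_eq_sum_ones, Nat.cast_sum]
  refine Finset.sum_involution (fun ε _ => Function.update ε k (-ε k)) ?_ ?_ ?_ ?_
  · intros
    decide
  · intro ε _ _ h
    have := congrFun h k
    simp at this
  · intro ε hε
    simp only [Finset.mem_filter, Finset.mem_univ, true_and] at hε ⊢
    exact fun c hc => (hε c hc).flip (hk c hc)
  · intro ε _
    simp

/-- The matrix of inner products is triangular with nonzero diagonal, hence invertible. -/
theorem linearIndependent_of_triangular {m : ℕ} {a b : Fin m → E}
    (h : ∀ k, IsLeading b (a k) k) : LinearIndependent ℝ a ∧ LinearIndependent ℝ b := by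
  set M : Matrix (Fin m) (Fin m) ℝ := Matrix.of fun k j => ⟪a k, b j⟫ with hM
  have hdet : M.det ≠ 0 := by
    have htri : M.IsUpperTriangular := fun k j hjk => (h k).1 j hjk
    rw [Matrix.det_of_isUpperTriangular htri]
    exact Finset.prod_ne_zero_iff.2 fun k _ => (h k).2
  constructor
  · rw [Fintype.linearIndependent_iff]
    intro g hg
    refine congrFun (Matrix.eq_zero_of_vecMul_eq_zero hdet ?_)
    ext j
    have := congrArg (fun z => ⟪z, b j⟫) hg
    simpa [sum_inner, real_inner_smul_left, Matrix.vecMul, dotProduct, hM] using this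
  · rw [Fintype.linearIndependent_iff]
    intro g hg
    refine congrFun (Matrix.eq_zero_of_mulVec_eq_zero hdet ?_)
    ext j
    have := congrArg (fun z => ⟪a j, z⟫) hg
    simpa [inner_sum, real_inner_smul_right, Matrix.mulVec, dotProduct, hM, mul_comm] using this

theorem eq_zero_of_forall_inner_eq_zero [FiniteDimensional ℝ E] {m : ℕ} {a : Fin m → E}
    (ha : LinearIndependent ℝ a) (hm : m = Module.finrank ℝ E) {y : E}
    (hy : ∀ k, ⟪a k, y⟫ = 0) : y = 0 := by
  have hspan := ha.span_eq_top_of_card_eq_finrank' (by simpa using hm)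
  have hle : Submodule.span ℝ (Set.range a) ≤ (Submodule.span ℝ {y})ᗮ := by
    rw [Submodule.span_le]
    rintro _ ⟨k, rfl⟩
    exact Submodule.mem_orthogonal_singleton_iff_inner_left.2 (hy k)
  have : y ∈ (Submodule.span ℝ {y})ᗮ := hle (hspan ▸ Submodule.mem_top)
  exact inner_self_eq_zero.1 (Submodule.mem_orthogonal_singleton_iff_inner_left.1 this)

end LexicographicSigns

/-! ### Extreme rays and complete flags of faces of a solid cone. -/

section FaceFlags

variable {E : Type*} [NormedAddCommGroup E] [InnerProductSpace ℝ E]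

/-- A nonzero point `v` of the cone cut out by `t` can be moved along the cone, keeping all its
active constraints, until a new one becomes active. -/
theorem exists_more_active (t : Finset E) {v y c₁ c₂ : E} (hv : ∀ c ∈ t, 0 ≤ ⟪c, v⟫)
    (hy : ∀ c ∈ t, ⟪c, v⟫ = 0 → ⟪c, y⟫ = 0) (hv₁ : 0 < ⟪c₁, v⟫) (hy₁ : ⟪c₁, y⟫ = 0)
    (hc₂ : c₂ ∈ t) (hy₂ : ⟪c₂, y⟫ < 0) :
    ∃ w, (∀ c ∈ t, 0 ≤ ⟪c, w⟫) ∧ 0 < ⟪c₁, w⟫ ∧ (∀ c ∈ t, ⟪c, v⟫ = 0 → ⟪c, w⟫ = 0) ∧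
      ∃ c ∈ t, ⟪c, w⟫ = 0 ∧ ⟪c, y⟫ ≠ 0 := by
  classical
  -- The minimal ratio is the time at which the ray `v + r • y` first meets a bounding hyperplane.
  obtain ⟨c, hc, hmin⟩ := Finset.exists_min_image (t.filter fun c => ⟪c, y⟫ < 0)
    (fun c => ⟪c, v⟫ / -⟪c, y⟫) ⟨c₂, by simp [hc₂, hy₂]⟩
  rw [Finset.mem_filter] at hc
  set r := ⟪c, v⟫ / -⟪c, y⟫ with hr
  have hr0 : 0 ≤ r := div_nonneg (hv c hc.1) (by linarith [hc.2])
  refine ⟨v + r • y, ?_, ?_, ?_, c, hc.1, ?_, hc.2.ne⟩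
  · intro e he
    rw [inner_add_right, real_inner_smul_right]
    rcases lt_or_ge ⟪e, y⟫ 0 with h | h
    · have := hmin e (by simp [he, h])
      rw [le_div_iff₀ (by linarith)] at this
      linarith
    · have := hv e he
      positivity
  · rw [inner_add_right, real_inner_smul_right, hy₁]
    simpa using hv₁
  · intro e he h
    rw [inner_add_right, real_inner_smul_right, h, hy e he h]
    simp
  · rw [inner_add_right, real_inner_smul_right, hr]
    have := hc.2.ne
    field_simp
    ring

variable [FiniteDimensional ℝ E]

/-- Otherwise `B` would lie in the double orthogonal complement of `A`, which is its span. -/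
theorem exists_mem_inner_ne_zero_of_span_lt {A B : Set E}
    (h : Submodule.span ℝ A < Submodule.span ℝ B) :
    ∃ y, (∀ c ∈ A, ⟪c, y⟫ = 0) ∧ ∃ c ∈ B, ⟪c, y⟫ ≠ 0 := by
  by_contra! hcon
  refine absurd h (not_lt_of_ge ?_)
  rw [← Submodule.orthogonal_orthogonal (Submodule.span ℝ A), Submodule.span_le]
  intro c hc
  rw [SetLike.mem_coe, Submodule.mem_orthogonal]
  intro y hy
  rw [real_inner_comm]
  refine hcon y (fun a ha => ?_) c hc
  exact (Submodule.mem_orthogonal _ _).1 hy a (Submodule.subset_span ha)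

/-- Existence of extreme rays, modulo the lineality space. -/
theorem exists_extreme_ray (t : Finset E) {p : E} (hp : ∀ c ∈ t, 0 < ⟪c, p⟫) (ht : t.Nonempty) :
    ∃ v, (∀ c ∈ t, 0 ≤ ⟪c, v⟫) ∧ (∃ c ∈ t, 0 < ⟪c, v⟫) ∧
      Module.finrank ℝ (Submodule.span ℝ {c | c ∈ t ∧ ⟪c, v⟫ = 0}) + 1
        = Module.finrank ℝ (Submodule.span ℝ (t : Set E)) := by
  let good : E → Prop := fun v => (∀ c ∈ t, 0 ≤ ⟪c, v⟫) ∧ ∃ c ∈ t, 0 < ⟪c, v⟫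
  let act : E → Set E := fun v => {c | c ∈ t ∧ ⟪c, v⟫ = 0}
  let rk : E → ℕ := fun v => Module.finrank ℝ (Submodule.span ℝ (act v))
  have hp' : good p := by
    obtain ⟨c, hc⟩ := ht
    exact ⟨fun c hc => (hp c hc).le, c, hc, hp c hc⟩
  -- An extreme ray is a point outside the lineality space whose active constraints have maximal
  -- rank.
  obtain ⟨v, hv, hmax⟩ : ∃ v, good v ∧ ∀ w, good w → rk w ≤ rk v := by
    have hfin : (rk '' {v | good v}).Finite :=
      (Set.finite_Iic (Module.finrank ℝ E)).subset (by
        rintro _ ⟨v, _, rfl⟩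
        exact Submodule.finrank_le _)
    obtain ⟨r, ⟨v, hv, rfl⟩, hr⟩ :=
      hfin.exists_maximal ⟨_, p, hp', rfl⟩
    refine ⟨v, hv, fun w hw => ?_⟩
    by_contra! hlt
    exact absurd (hr ⟨w, hw, rfl⟩ hlt.le) (not_le_of_gt hlt)
  obtain ⟨hv0, c₁, hc₁, hv₁⟩ := hv
  refine ⟨v, hv0, ⟨c₁, hc₁, hv₁⟩, ?_⟩
  have hactv : ∀ c ∈ Submodule.span ℝ (act v), ⟪c, v⟫ = 0 := by
    intro c hc
    have : Submodule.span ℝ (act v) ≤ (Submodule.span ℝ {v})ᗮ := by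
      rw [Submodule.span_le]
      intro c hc
      exact Submodule.mem_orthogonal_singleton_iff_inner_left.2 hc.2
    exact Submodule.mem_orthogonal_singleton_iff_inner_left.1 (this hc)
  have hle : Submodule.span ℝ (insert c₁ (act v)) ≤ Submodule.span ℝ (t : Set E) :=
    Submodule.span_mono (Set.insert_subset hc₁ fun c hc => hc.1)
  have hrank : Module.finrank ℝ (Submodule.span ℝ (insert c₁ (act v))) = rk v + 1 := by
    rw [Submodule.span_insert, sup_comm]
    refine Submodule.finrank_sup_span_singleton fun hc => ?_
    exact hv₁.ne' (hactv _ hc)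
  rcases hle.lt_or_eq with hlt | heq
  · exfalso
    obtain ⟨y, hy, c₂, hc₂, hy₂⟩ := exists_mem_inner_ne_zero_of_span_lt hlt
    obtain ⟨y, hy, hy₂⟩ : ∃ y, (∀ c ∈ insert c₁ (act v), ⟪c, y⟫ = 0) ∧ ⟪c₂, y⟫ < 0 := by
      rcases hy₂.lt_or_gt with h | h
      · exact ⟨y, hy, h⟩
      · exact ⟨-y, fun c hc => by simp [hy c hc], by simpa using h⟩
    obtain ⟨w, hw0, hw₁, hwact, c, hc, hcw, hcy⟩ := exists_more_active t hv0
      (fun c hc h => hy c (Or.inr ⟨hc, h⟩)) hv₁ (hy c₁ (Or.inl rfl)) hc₂ hy₂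
    -- The new active constraint is not orthogonal to `y`, while all those active at `v` are.
    have hlt' : Submodule.span ℝ (act v) < Submodule.span ℝ (act w) := by
      refine lt_of_le_of_ne (Submodule.span_mono fun e he => ⟨he.1, hwact e he.1 he.2⟩) ?_
      intro heq
      have hcv : c ∈ Submodule.span ℝ (act v) := heq ▸ Submodule.subset_span ⟨hc, hcw⟩
      have : Submodule.span ℝ (act v) ≤ (Submodule.span ℝ {y})ᗮ := by
        rw [Submodule.span_le]
        intro e he
        exact Submodule.mem_orthogonal_singleton_iff_inner_left.2 (hy e (Or.inr he))
      exact hcy (Submodule.mem_orthogonal_singleton_iff_inner_left.1 (this hcv))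
    exact absurd (hmax w ⟨hw0, c₁, hc₁, hw₁⟩) (not_le_of_gt (Submodule.finrank_lt_finrank_of_lt hlt'))
  · rw [← heq, hrank]

/-- A solid cone, cut out by `t`, has a complete flag of faces. -/
theorem exists_face_flag {r : ℕ} (t : Finset E) {p : E} (hp : ∀ c ∈ t, 0 < ⟪c, p⟫)
    (hr : Module.finrank ℝ (Submodule.span ℝ (t : Set E)) = r) :
    ∃ w : Fin r → E, (∀ k, ∃ c ∈ t, IsLeading w c k) ∧
      ∀ c ∈ t, ∀ k, IsLeading w c k → 0 < ⟪c, w k⟫ := by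
  classical
  induction r generalizing t with
  | zero => exact ⟨Fin.elim0, fun k => k.elim0, fun _ _ k => k.elim0⟩
  | succ r ih =>
    have ht : t.Nonempty := by
      rw [Finset.nonempty_iff_ne_empty]
      rintro rfl
      rw [Finset.coe_empty, Submodule.span_empty, finrank_bot] at hr
      omega
    obtain ⟨v, hv, ⟨c₁, hc₁, hv₁⟩, hrank⟩ := exists_extreme_ray t hp ht
    -- The constraints active at the extreme ray `v` have rank one less; `v` is put in front of
    -- their flag.
    obtain ⟨w, hw, hwpos⟩ := ih (t.filter fun c => ⟪c, v⟫ = 0)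
      (fun c hc => hp c (Finset.mem_filter.1 hc).1) (by
        rw [hr] at hrank
        rw [Finset.coe_filter]
        exact Nat.succ_injective hrank)
    refine ⟨Fin.cons v w, fun k => ?_, fun c hc k hk => ?_⟩
    · refine Fin.cases ⟨c₁, hc₁, fun j hj => absurd hj (Fin.not_lt_zero j), by simpa using hv₁.ne'⟩
        (fun k => ?_) k
      obtain ⟨c, hc, hck⟩ := hw k
      rw [Finset.mem_filter] at hc
      refine ⟨c, hc.1, fun j => Fin.cases (fun _ => by simpa using hc.2) (fun j hj => ?_) j,
        by simpa using hck.2⟩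
      simpa using hck.1 j (Fin.succ_lt_succ_iff.1 hj)
    · revert hk
      refine Fin.cases (fun hk => ?_) (fun k hk => ?_) k
      · have h2 : ⟪c, v⟫ ≠ 0 := by simpa using hk.2
        simpa using lt_of_le_of_ne (hv c hc) h2.symm
      · have h0 : ⟪c, v⟫ = 0 := by simpa using hk.1 0 (Fin.succ_pos k)
        have := hwpos c (by simp [hc, h0]) k ⟨fun j hj => by
          simpa using hk.1 j.succ (Fin.succ_lt_succ_iff.2 hj), by simpa using hk.2⟩
        simpa using this

end FaceFlags


/-! ### Interiors of polytopes and descriptions of tilings. -/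

namespace UnitSphere

variable {n : ℕ}

theorem exists_pos_smul_eq {z : EuclideanSpace ℝ (Fin (n + 1))} (hz : z ≠ 0) :
    ∃ (y : UnitSphere n) (r : ℝ), 0 < r ∧ z = r • (y : EuclideanSpace ℝ (Fin (n + 1))) := by
  refine ⟨⟨‖z‖⁻¹ • z, by simp [norm_smul, hz]⟩, ‖z‖, norm_pos_iff.2 hz, ?_⟩
  simp [smul_smul, hz]

theorem mem_interior_of_forall_inner_pos {s : Finset (EuclideanSpace ℝ (Fin (n + 1)))}
    {y : UnitSphere n} (hy : ∀ c ∈ s, 0 < ⟪c, (y : EuclideanSpace ℝ (Fin (n + 1)))⟫) :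
    y ∈ interior {y : UnitSphere n | ∀ c ∈ s, 0 ≤ ⟪c, (y : EuclideanSpace ℝ (Fin (n + 1)))⟫} := by
  rw [mem_interior_iff_mem_nhds]
  change ∀ᶠ z : UnitSphere n in nhds y, ∀ c ∈ s, 0 ≤ ⟪c, (z : EuclideanSpace ℝ (Fin (n + 1)))⟫
  rw [Filter.eventually_all_finset]
  intro c hc
  have hcont : Continuous fun z : UnitSphere n => ⟪c, (z : EuclideanSpace ℝ (Fin (n + 1)))⟫ := by
    fun_prop
  filter_upwards [hcont.continuousAt.eventually (lt_mem_nhds (hy c hc))] with z hz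
  exact le_of_lt hz

/-- If `c` vanished at `y`, moving from `y` in direction `-c` would leave the polytope at once. -/
theorem inner_pos_of_mem_interior {s : Finset (EuclideanSpace ℝ (Fin (n + 1)))}
    (hs : ∀ c ∈ s, c ≠ 0) {y : UnitSphere n}
    (hy : y ∈ interior
      {y : UnitSphere n | ∀ c ∈ s, 0 ≤ ⟪c, (y : EuclideanSpace ℝ (Fin (n + 1)))⟫})
    {c : EuclideanSpace ℝ (Fin (n + 1))} (hc : c ∈ s) :
    0 < ⟪c, (y : EuclideanSpace ℝ (Fin (n + 1)))⟫ := by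
  refine lt_of_le_of_ne (interior_subset hy c hc) fun h0 => ?_
  have hne : ∀ t : ℝ, (y : EuclideanSpace ℝ (Fin (n + 1))) - t • c ≠ 0 := by
    intro t h
    have := congrArg (fun z => ⟪z, (y : EuclideanSpace ℝ (Fin (n + 1)))⟫) h
    simp [inner_sub_left, real_inner_smul_left, ← h0] at this
  let f : ℝ → UnitSphere n := fun t =>
    ⟨‖(y : EuclideanSpace ℝ (Fin (n + 1))) - t • c‖⁻¹ •
      ((y : EuclideanSpace ℝ (Fin (n + 1))) - t • c), by
        simp [norm_smul, hne t]⟩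
  have hf : Continuous f := by
    have h : Continuous fun t : ℝ => (y : EuclideanSpace ℝ (Fin (n + 1))) - t • c := by fun_prop
    exact ((h.norm.inv₀ fun t => norm_ne_zero_iff.2 (hne t)).smul h).subtype_mk _
  have hf0 : f 0 = y := by
    ext1
    simp [f]
  have hev : ∀ᶠ t in nhdsWithin (0 : ℝ) (Set.Ioi 0), f t ∈
      {y : UnitSphere n | ∀ c ∈ s, 0 ≤ ⟪c, (y : EuclideanSpace ℝ (Fin (n + 1)))⟫} := by
    refine nhdsWithin_le_nhds (hf.continuousAt.eventually ?_)
    rw [hf0]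
    exact mem_interior_iff_mem_nhds.1 hy
  obtain ⟨t, ht, htpos⟩ := (hev.and self_mem_nhdsWithin).exists
  have h1 := ht c hc
  simp only [f, real_inner_smul_right, inner_sub_right, ← h0, real_inner_self_eq_norm_sq,
    zero_sub] at h1
  have h2 : 0 < ‖(y : EuclideanSpace ℝ (Fin (n + 1))) - t • c‖⁻¹ :=
    inv_pos.2 (norm_pos_iff.2 (hne t))
  have h3 : 0 < t * ‖c‖ ^ 2 := mul_pos htpos (pow_pos (norm_pos_iff.2 (hs c hc)) 2)
  nlinarith [mul_pos h2 h3]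

theorem IsLocallyFiniteTiling.finite {T : Set (Set (UnitSphere n))}
    (hT : IsLocallyFiniteTiling T) : T.Finite := by
  refine (hT.locallyFinite Set.univ (Metric.isBounded_of_compactSpace)).subset fun Q hQ => ⟨hQ, ?_⟩
  rw [Set.inter_univ]
  exact (hT.interior_nonempty Q hQ).mono interior_subset

/-- `s` describes every tile `Q` of `T` as the intersection of the sphere with the halfspaces
given by `s Q`. -/
def IsDescription (T : Set (Set (UnitSphere n)))
    (s : Set (UnitSphere n) → Finset (EuclideanSpace ℝ (Fin (n + 1)))) : Prop :=
  ∀ Q ∈ T, (∀ c ∈ s Q, c ≠ 0) ∧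
    Q = {y : UnitSphere n | ∀ c ∈ s Q, 0 ≤ ⟪c, (y : EuclideanSpace ℝ (Fin (n + 1)))⟫}

theorem IsLocallyFiniteTiling.exists_isDescription {T : Set (Set (UnitSphere n))}
    (hT : IsLocallyFiniteTiling T) : ∃ s, IsDescription T s := by
  classical
  choose! s hs using hT.isPolytope
  exact ⟨s, hs⟩

/-! ### Distribution of the sign vectors among the tiles. -/

section Orthants

variable {T : Set (Set (UnitSphere n))}
  {s : Set (UnitSphere n) → Finset (EuclideanSpace ℝ (Fin (n + 1)))}
  {v : Fin (n + 1) → EuclideanSpace ℝ (Fin (n + 1))}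

theorem exists_isLeading_of_ne_zero (hv : LinearIndependent ℝ v)
    {c : EuclideanSpace ℝ (Fin (n + 1))} (hc : c ≠ 0) : ∃ k, IsLeading v c k := by
  refine exists_isLeading ?_
  by_contra! h
  exact hc (eq_zero_of_forall_inner_eq_zero hv (by simp) fun k => by
    rw [real_inner_comm]
    exact h k)

theorem exists_tile_lexPos (hT : IsLocallyFiniteTiling T) (hs : IsDescription T s)
    (hv : LinearIndependent ℝ v) (ε : Fin (n + 1) → ℤˣ) :
    ∃ Q ∈ T, ∀ c ∈ s Q, LexPos v ε c := by
  by_contra! hcon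
  choose! c hc hlex using hcon
  -- There are finitely many tiles, so a common small `δ` gives a point that none of them covers.
  have hneg : ∀ Q ∈ T, ∀ᶠ δ in nhdsWithin (0 : ℝ) (Set.Ioi 0), ⟪c Q, lexCurve v ε δ⟫ < 0 := by
    intro Q hQ
    obtain ⟨k, hk⟩ := exists_isLeading_of_ne_zero hv ((hs Q hQ).1 _ (hc Q hQ))
    have := ((hk.lexPos_or_neg ε).resolve_left (hlex Q hQ)).eventually_inner_lexCurve_pos
    filter_upwards [this] with δ hδ
    rw [inner_neg_left] at hδ
    linarith
  obtain ⟨δ, hδ⟩ := ((Filter.eventually_all_finite hT.finite).2 hneg).exists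
  obtain ⟨Q₀, hQ₀⟩ : ∃ Q, Q ∈ T := by
    have : (⟨EuclideanSpace.single 0 1, by simp⟩ : UnitSphere n) ∈ ⋃₀ T := by
      rw [hT.covering]
      trivial
    obtain ⟨Q, hQ, -⟩ := this
    exact ⟨Q, hQ⟩
  have hne : lexCurve v ε δ ≠ 0 := fun h => by
    have := hδ Q₀ hQ₀
    simp [h] at this
  obtain ⟨y, r, hr, hy⟩ := exists_pos_smul_eq hne
  obtain ⟨Q, hQ, hyQ⟩ : y ∈ ⋃₀ T := by
    rw [hT.covering]
    trivial
  rw [(hs Q hQ).2] at hyQ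
  have h1 := hyQ _ (hc Q hQ)
  have h2 := hδ Q hQ
  rw [hy, real_inner_smul_right] at h2
  exact absurd (mul_nonneg hr.le h1) (not_le_of_gt h2)

/-- For small `δ` the normalised curve point would be interior to both tiles. -/
theorem eq_of_lexPos (hT : IsLocallyFiniteTiling T) (hs : IsDescription T s)
    {ε : Fin (n + 1) → ℤˣ} {Q R : Set (UnitSphere n)}
    (hQ : Q ∈ T) (hR : R ∈ T) (hQε : ∀ c ∈ s Q, LexPos v ε c) (hRε : ∀ c ∈ s R, LexPos v ε c)
    (hv : LinearIndependent ℝ v) : Q = R := by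
  by_contra hne
  have hev : ∀ S, (∀ c ∈ s S, LexPos v ε c) →
      ∀ᶠ δ in nhdsWithin (0 : ℝ) (Set.Ioi 0), ∀ c ∈ s S, 0 < ⟪c, lexCurve v ε δ⟫ := fun S hS =>
    (Filter.eventually_all_finset _).2 fun c hc => (hS c hc).eventually_inner_lexCurve_pos
  have hne0 : ∀ᶠ δ in nhdsWithin (0 : ℝ) (Set.Ioi 0), lexCurve v ε δ ≠ 0 := by
    obtain ⟨k, hk⟩ := exists_isLeading_of_ne_zero hv (hv.ne_zero 0)
    rcases hk.lexPos_or_neg ε with h | h <;>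
    · filter_upwards [h.eventually_inner_lexCurve_pos] with δ hδ h0
      simp [h0] at hδ
  obtain ⟨δ, ⟨hδQ, hδR⟩, hδ⟩ := (((hev Q hQε).and (hev R hRε)).and hne0).exists
  obtain ⟨y, r, hr, hy⟩ := exists_pos_smul_eq hδ
  have hmem : ∀ S ∈ T, (∀ c ∈ s S, 0 < ⟪c, lexCurve v ε δ⟫) → y ∈ interior S := by
    intro S hS h
    rw [(hs S hS).2]
    refine mem_interior_of_forall_inner_pos fun c hc => ?_
    have := h c hc
    rw [hy, real_inner_smul_right] at this
    exact pos_of_mul_pos_right this hr.le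
  exact Set.disjoint_left.1 (hT.packing Q hQ R hR hne) (hmem Q hQ hδQ) (hmem R hR hδR)

open Classical in
theorem sum_card_lexPos (hT : IsLocallyFiniteTiling T) (hs : IsDescription T s)
    (hv : LinearIndependent ℝ v) :
    ∑ Q ∈ hT.finite.toFinset,
      (Finset.univ.filter fun ε : Fin (n + 1) → ℤˣ => ∀ c ∈ s Q, LexPos v ε c).card
      = 2 ^ (n + 1) := by
  choose t ht hlex using exists_tile_lexPos hT hs hv
  have hcard : (Finset.univ : Finset (Fin (n + 1) → ℤˣ)).card = 2 ^ (n + 1) := by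
    simp
  rw [← hcard, Finset.card_eq_sum_card_fiberwise (f := t) (t := hT.finite.toFinset)
    (fun ε _ => by simpa using ht ε)]
  refine Finset.sum_congr rfl fun Q hQ => congrArg Finset.card ?_
  rw [Set.Finite.mem_toFinset] at hQ
  ext ε
  simp only [Finset.mem_filter, Finset.mem_univ, true_and]
  constructor
  · exact fun h => eq_of_lexPos hT hs (ht ε) hQ (hlex ε) h hv
  · rintro rfl
    exact hlex ε

end Orthants

/-! ### Vertices, flags and leading constraints. -/

/-- A polytope whose constraints lead at every index of some family is of A-type. -/
theorem isAType_of_isLeading {s : Finset (EuclideanSpace ℝ (Fin (n + 1)))}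
    {v : Fin (n + 1) → EuclideanSpace ℝ (Fin (n + 1))} (h : ∀ k, ∃ c ∈ s, IsLeading v c k) :
    IsAType {y : UnitSphere n | ∀ c ∈ s, 0 ≤ ⟪c, (y : EuclideanSpace ℝ (Fin (n + 1)))⟫} := by
  rintro ⟨y, hy, hy'⟩
  choose a ha hlead using h
  have : (y : EuclideanSpace ℝ (Fin (n + 1))) = 0 := by
    refine eq_zero_of_forall_inner_eq_zero (linearIndependent_of_triangular hlead).1 (by simp)
      fun k => le_antisymm ?_ (hy _ (ha k))
    have := hy' _ (ha k)
    simp only [coe_neg_sphere, inner_neg_right] at this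
    linarith
  exact ne_zero_of_mem_unit_sphere y this

theorem inner_nonneg_of_forall_mem {s : Finset (EuclideanSpace ℝ (Fin (n + 1)))}
    {c₀ : EuclideanSpace ℝ (Fin (n + 1))}
    (h : ∀ y ∈ {y : UnitSphere n | ∀ c ∈ s, 0 ≤ ⟪c, (y : EuclideanSpace ℝ (Fin (n + 1)))⟫},
      0 ≤ ⟪c₀, (y : EuclideanSpace ℝ (Fin (n + 1)))⟫)
    {z : EuclideanSpace ℝ (Fin (n + 1))} (hz : ∀ c ∈ s, 0 ≤ ⟪c, z⟫) : 0 ≤ ⟪c₀, z⟫ := by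
  rcases eq_or_ne z 0 with rfl | h0
  · simp
  obtain ⟨y, r, hr, rfl⟩ := exists_pos_smul_eq h0
  rw [real_inner_smul_right]
  refine mul_nonneg hr.le (h y fun c hc => ?_)
  have := hz c hc
  rw [real_inner_smul_right] at this
  exact nonneg_of_mul_nonneg_right this hr

/-- The constraints active at a vertex determine it up to a scalar. -/
theorem mem_span_of_active {s : Finset (EuclideanSpace ℝ (Fin (n + 1)))} {x : UnitSphere n}
    (hx : IsVertex x {y : UnitSphere n | ∀ c ∈ s, 0 ≤ ⟪c, (y : EuclideanSpace ℝ (Fin (n + 1)))⟫})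
    {y : EuclideanSpace ℝ (Fin (n + 1))}
    (hy : ∀ c ∈ s, ⟪c, (x : EuclideanSpace ℝ (Fin (n + 1)))⟫ = 0 → ⟪c, y⟫ = 0) :
    y ∈ Submodule.span ℝ {(x : EuclideanSpace ℝ (Fin (n + 1)))} := by
  obtain ⟨F, ⟨c₀, hc₀, rfl⟩, ⟨hxP, hx0⟩, hF⟩ := hx
  -- For small `t` both `x + t • y` and `x - t • y` lie in the cone. As `c₀` vanishes at `x`, it
  -- then vanishes at `x + t • y`, which must lie on the line through `x`.
  have hev : ∀ᶠ t in nhdsWithin (0 : ℝ) (Set.Ioi 0), ∀ c ∈ s,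
      0 ≤ ⟪c, (x : EuclideanSpace ℝ (Fin (n + 1))) + t • y⟫ ∧
      0 ≤ ⟪c, (x : EuclideanSpace ℝ (Fin (n + 1))) - t • y⟫ := by
    rw [Filter.eventually_all_finset]
    intro c hc
    rcases (hxP c hc).eq_or_lt with h | h
    · refine Filter.Eventually.of_forall fun t => ?_
      simp [inner_add_right, inner_sub_right, real_inner_smul_right, ← h, hy c hc h.symm]
    · have h1 : Continuous fun t : ℝ => ⟪c, (x : EuclideanSpace ℝ (Fin (n + 1))) + t • y⟫ := by
        fun_prop
      have h2 : Continuous fun t : ℝ => ⟪c, (x : EuclideanSpace ℝ (Fin (n + 1))) - t • y⟫ := by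
        fun_prop
      have h1' : ∀ᶠ t in nhds (0 : ℝ),
          0 < ⟪c, (x : EuclideanSpace ℝ (Fin (n + 1))) + t • y⟫ :=
        h1.continuousAt.eventually (lt_mem_nhds (by simpa using h))
      have h2' : ∀ᶠ t in nhds (0 : ℝ),
          0 < ⟪c, (x : EuclideanSpace ℝ (Fin (n + 1))) - t • y⟫ :=
        h2.continuousAt.eventually (lt_mem_nhds (by simpa using h))
      filter_upwards [nhdsWithin_le_nhds h1', nhdsWithin_le_nhds h2'] with t ht1 ht2
      exact ⟨le_of_lt ht1, le_of_lt ht2⟩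
  obtain ⟨t, ht, htpos⟩ := (hev.and self_mem_nhdsWithin).exists
  have htpos : 0 < t := htpos
  have hp := inner_nonneg_of_forall_mem hc₀ fun c hc => (ht c hc).1
  have hm := inner_nonneg_of_forall_mem hc₀ fun c hc => (ht c hc).2
  have hp0 : ⟪c₀, (x : EuclideanSpace ℝ (Fin (n + 1))) + t • y⟫ = 0 := by
    rw [inner_add_right, hx0] at hp ⊢
    rw [inner_sub_right, hx0] at hm
    linarith
  have hx1 := Submodule.mem_span_singleton_self (R := ℝ) (x : EuclideanSpace ℝ (Fin (n + 1)))
  have hmem : (x : EuclideanSpace ℝ (Fin (n + 1))) + t • y ∈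
      Submodule.span ℝ {(x : EuclideanSpace ℝ (Fin (n + 1)))} := by
    rcases eq_or_ne ((x : EuclideanSpace ℝ (Fin (n + 1))) + t • y) 0 with h0 | h0
    · rw [h0]
      exact zero_mem _
    · obtain ⟨z, r, hr, hz⟩ := exists_pos_smul_eq h0
      rw [hz]
      refine Submodule.smul_mem _ _ ?_
      have hzF := @hF z ⟨fun c hc => ?_, ?_⟩
      · rcases hzF with rfl | hzF
        · exact hx1
        · rw [Set.mem_singleton_iff.1 hzF, coe_neg_sphere]
          exact neg_mem hx1
      · have := (ht c hc).1
        rw [hz, real_inner_smul_right] at this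
        exact nonneg_of_mul_nonneg_right this hr
      · rw [hz, real_inner_smul_right] at hp0
        exact (mul_eq_zero.1 hp0).resolve_left hr.ne'
  have := Submodule.smul_mem _ t⁻¹ (Submodule.sub_mem _ hmem hx1)
  simpa [smul_smul, htpos.ne'] using this

theorem IsVertex.mem {x : UnitSphere n} {P : Set (UnitSphere n)} (h : IsVertex x P) : x ∈ P := by
  obtain ⟨F, ⟨c, -, rfl⟩, hx, -⟩ := h
  exact hx.1

/-- A vertex of an A-type polytope starts a complete flag of faces. -/
theorem exists_flag_of_isVertex {s : Finset (EuclideanSpace ℝ (Fin (n + 1)))} {x : UnitSphere n}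
    {P : Set (UnitSphere n)}
    (hP : P = {y : UnitSphere n | ∀ c ∈ s, 0 ≤ ⟪c, (y : EuclideanSpace ℝ (Fin (n + 1)))⟫})
    (hs : ∀ c ∈ s, c ≠ 0) (hint : (interior P).Nonempty) (hA : IsAType P) (hx : IsVertex x P) :
    ∃ v : Fin (n + 1) → EuclideanSpace ℝ (Fin (n + 1)), v 0 = x ∧
      (∀ k, ∃ c ∈ s, IsLeading v c k) ∧ ∀ c ∈ s, ∀ k, IsLeading v c k → 0 < ⟪c, v k⟫ := by
  classical
  obtain ⟨p, hp⟩ := hint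
  have hxP : x ∈ P := hx.mem
  subst hP
  set t := s.filter fun c => ⟪c, (x : EuclideanSpace ℝ (Fin (n + 1)))⟫ = 0 with ht
  -- So the active constraints have rank `n`, and their flag has exactly the `n` vectors needed
  -- after `x`.
  have horth : (Submodule.span ℝ (t : Set (EuclideanSpace ℝ (Fin (n + 1)))))ᗮ
      = Submodule.span ℝ {(x : EuclideanSpace ℝ (Fin (n + 1)))} := by
    refine le_antisymm (fun y hy => mem_span_of_active hx fun c hc h => ?_) ?_
    · exact (Submodule.mem_orthogonal _ _).1 hy c (Submodule.subset_span (by simp [ht, hc, h]))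
    · rw [Submodule.span_singleton_le_iff_mem, Submodule.mem_orthogonal]
      intro c hc
      have hle : Submodule.span ℝ (t : Set (EuclideanSpace ℝ (Fin (n + 1)))) ≤
          (Submodule.span ℝ {(x : EuclideanSpace ℝ (Fin (n + 1)))})ᗮ := by
        rw [Submodule.span_le]
        intro c hc
        exact Submodule.mem_orthogonal_singleton_iff_inner_left.2 (Finset.mem_filter.1 hc).2
      exact Submodule.mem_orthogonal_singleton_iff_inner_left.1 (hle hc)
  have hrank : Module.finrank ℝ
      (Submodule.span ℝ (t : Set (EuclideanSpace ℝ (Fin (n + 1))))) = n := by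
    have := Submodule.finrank_add_finrank_orthogonal
      (Submodule.span ℝ (t : Set (EuclideanSpace ℝ (Fin (n + 1)))))
    rw [horth, finrank_span_singleton (ne_zero_of_mem_unit_sphere x),
      finrank_euclideanSpace_fin] at this
    omega
  obtain ⟨w, hw, hwpos⟩ := exists_face_flag t (fun c hc => inner_pos_of_mem_interior hs hp
    (Finset.mem_filter.1 hc).1) hrank
  -- Otherwise `-x` would also lie in the polytope, against A-type.
  obtain ⟨c₁, hc₁, hx₁⟩ : ∃ c ∈ s, 0 < ⟪c, (x : EuclideanSpace ℝ (Fin (n + 1)))⟫ := by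
    by_contra! h
    refine hA ⟨x, hxP, fun c hc => ?_⟩
    have := h c hc
    simp only [coe_neg_sphere, inner_neg_right]
    linarith
  refine ⟨Fin.cons x w, rfl, fun k => ?_, fun c hc k hk => ?_⟩
  · refine Fin.cases ⟨c₁, hc₁, fun j hj => absurd hj (Fin.not_lt_zero j), by simpa using hx₁.ne'⟩
      (fun k => ?_) k
    obtain ⟨c, hc, hck⟩ := hw k
    rw [Finset.mem_filter] at hc
    refine ⟨c, hc.1, fun j => Fin.cases (fun _ => by simpa using hc.2) (fun j hj => ?_) j,
      by simpa using hck.2⟩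
    simpa using hck.1 j (Fin.succ_lt_succ_iff.1 hj)
  · revert hk
    refine Fin.cases (fun hk => ?_) (fun k hk => ?_) k
    · have h2 : ⟪c, (x : EuclideanSpace ℝ (Fin (n + 1)))⟫ ≠ 0 := by simpa using hk.2
      simpa using lt_of_le_of_ne (hxP c hc) h2.symm
    · have h0 : ⟪c, (x : EuclideanSpace ℝ (Fin (n + 1)))⟫ = 0 := by
        simpa using hk.1 0 (Fin.succ_pos k)
      have := hwpos c (by simp [ht, hc, h0]) k ⟨fun j hj => by
        simpa using hk.1 j.succ (Fin.succ_lt_succ_iff.2 hj), by simpa using hk.2⟩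
      simpa using this

/-- The sum of constraints leading at the positive indices supports the required face: each summand
is nonnegative on `P`, and their common zeros form the line through `x`. -/
theorem isVertex_of_isLeading {s : Finset (EuclideanSpace ℝ (Fin (n + 1)))} {x z : UnitSphere n}
    {P : Set (UnitSphere n)}
    (hP : P = {y : UnitSphere n | ∀ c ∈ s, 0 ≤ ⟪c, (y : EuclideanSpace ℝ (Fin (n + 1)))⟫})
    {v : Fin (n + 1) → EuclideanSpace ℝ (Fin (n + 1))} (hv : v 0 = x)
    (h : ∀ k, ∃ c ∈ s, IsLeading v c k) (hzP : z ∈ P) (hz : z = x ∨ z = -x) : IsVertex z P := by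
  choose a ha hlead using h
  have hax : ∀ k : Fin n, ⟪a k.succ, (x : EuclideanSpace ℝ (Fin (n + 1)))⟫ = 0 := fun k =>
    hv ▸ (hlead k.succ).1 0 (Fin.succ_pos k)
  have hsum : ∀ y : EuclideanSpace ℝ (Fin (n + 1)),
      ⟪∑ k : Fin n, a k.succ, y⟫ = ∑ k : Fin n, ⟪a k.succ, y⟫ := fun y => sum_inner _ _ _
  have hnonneg : ∀ y ∈ P, ∀ k : Fin n,
      0 ≤ ⟪a k.succ, (y : EuclideanSpace ℝ (Fin (n + 1)))⟫ := fun y hy k => by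
    rw [hP] at hy
    exact hy _ (ha _)
  have hsub : ∀ y : UnitSphere n,
      (∀ k : Fin n, ⟪a k.succ, (y : EuclideanSpace ℝ (Fin (n + 1)))⟫ = 0) → y = x ∨ y = -x := by
    intro y hy
    have h0 : ⟪a 0, (x : EuclideanSpace ℝ (Fin (n + 1)))⟫ ≠ 0 := hv ▸ (hlead 0).2
    set r := ⟪a 0, (y : EuclideanSpace ℝ (Fin (n + 1)))⟫ /
      ⟪a 0, (x : EuclideanSpace ℝ (Fin (n + 1)))⟫ with hr
    have hyr : (y : EuclideanSpace ℝ (Fin (n + 1))) - r • (x : EuclideanSpace ℝ (Fin (n + 1)))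
        = 0 := by
      refine eq_zero_of_forall_inner_eq_zero (linearIndependent_of_triangular hlead).1 (by simp)
        fun k => ?_
      rw [inner_sub_right, real_inner_smul_right]
      refine Fin.cases ?_ (fun k => ?_) k
      · rw [hr, div_mul_cancel₀ _ h0, sub_self]
      · rw [hy, hax, mul_zero, sub_zero]
    rw [sub_eq_zero] at hyr
    have habs : |r| = 1 := by
      have := congrArg norm hyr
      simpa [norm_smul] using this.symm
    rcases (abs_eq zero_le_one).1 habs with h | h
    · left
      ext1
      rw [hyr, h, one_smul]
    · right
      ext1
      rw [hyr, h, coe_neg_sphere, neg_one_smul]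
  refine ⟨_, ⟨∑ k : Fin n, a k.succ, fun y hy => ?_, rfl⟩, ⟨hzP, ?_⟩, ?_⟩
  · rw [hsum]
    exact Finset.sum_nonneg fun k _ => hnonneg y hy k
  · rw [hsum]
    refine Finset.sum_eq_zero fun k _ => ?_
    rcases hz with rfl | rfl
    · exact hax k
    · rw [coe_neg_sphere, inner_neg_right, hax k, neg_zero]
  · rintro y ⟨hyP, hy⟩
    rw [hsum, Finset.sum_eq_zero_iff_of_nonneg fun k _ => hnonneg y hyP k] at hy
    have hyx := hsub y fun k => hy k (Finset.mem_univ k)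
    rcases hz with rfl | rfl
    · exact hyx
    · rcases hyx with h | h
      · right
        simp [h]
      · exact Or.inl h

/-! ### The parity argument. -/

/-- With exactly two A-type tiles, a vertex of one is a vertex of the other up to sign. -/
theorem isVertex_or_isVertex_neg {T : Set (Set (UnitSphere n))} (hT : IsLocallyFiniteTiling T)
    {P P' : Set (UnitSphere n)} (hA : {Q ∈ T | IsAType Q} = {P, P'})
    {x : UnitSphere n} (hx : IsVertex x P) : IsVertex x P' ∨ IsVertex (-x) P' := by
  classical
  obtain ⟨s, hs⟩ := hT.exists_isDescription
  obtain ⟨hPT, hPA⟩ : P ∈ T ∧ IsAType P := by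
    have : P ∈ {Q ∈ T | IsAType Q} := by simp [hA]
    exact this
  obtain ⟨hPT', -⟩ : P' ∈ T ∧ IsAType P' := by
    have : P' ∈ {Q ∈ T | IsAType Q} := by simp [hA]
    exact this
  obtain ⟨v, hvx, hlead, hpos⟩ := exists_flag_of_isVertex (hs P hPT).2 (hs P hPT).1
    (hT.interior_nonempty P hPT) hPA hx
  have hv : LinearIndependent ℝ v := by
    choose a _ ha using hlead
    exact (linearIndependent_of_triangular ha).2
  let N : Set (UnitSphere n) → ℕ := fun Q =>
    (Finset.univ.filter fun ε : Fin (n + 1) → ℤˣ => ∀ c ∈ s Q, LexPos v ε c).card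
  -- Every index leads for `P`, with positive value, which forces every sign to be `1`.
  have hNP : N P = 1 := by
    refine Finset.card_eq_one.2 ⟨fun _ => 1, ?_⟩
    ext ε
    simp only [Finset.mem_filter, Finset.mem_univ, true_and, Finset.mem_singleton]
    constructor
    · intro h
      ext1 k
      obtain ⟨c, hc, hck⟩ := hlead k
      obtain ⟨l, hl, hlpos⟩ := (h c hc).isLeading
      obtain rfl := hl.unique hck
      rcases Int.units_eq_one_or (ε l) with h1 | h1
      · exact h1
      · have := hpos c hc l hck
        rw [h1] at hlpos
        simp at hlpos
        linarith
    · rintro rfl c hc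
      obtain ⟨k, hk⟩ := exists_isLeading_of_ne_zero hv ((hs P hPT).1 c hc)
      exact ⟨k, hk.1, by simpa using hpos c hc k hk⟩
  have heven : ∀ Q ∈ T, (¬ ∀ k, ∃ c ∈ s Q, IsLeading v c k) → Even (N Q) := by
    intro Q _ h
    push Not at h
    obtain ⟨k, hk⟩ := h
    exact even_card_filter_lexPos hk
  have hodd : Odd (N P') := by
    by_contra hcon
    have htotal : ∑ Q ∈ hT.finite.toFinset, N Q = 2 ^ (n + 1) := sum_card_lexPos hT hs hv
    rw [← Finset.add_sum_erase _ _ (hT.finite.mem_toFinset.2 hPT), hNP] at htotal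
    have hrest : Even (∑ Q ∈ hT.finite.toFinset.erase P, N Q) := by
      refine Finset.even_sum _ fun Q hQ => ?_
      rw [Finset.mem_erase, Set.Finite.mem_toFinset] at hQ
      rcases eq_or_ne Q P' with rfl | hQ'
      · exact Nat.not_odd_iff_even.1 hcon
      · refine heven Q hQ.2 fun hall => ?_
        have hQA : Q ∈ {Q ∈ T | IsAType Q} := ⟨hQ.2, by
          rw [(hs Q hQ.2).2]
          exact isAType_of_isLeading hall⟩
        rw [hA] at hQA
        rcases hQA with h | h
        · exact hQ.1 h
        · exact hQ' h
    have h2 : Even (2 ^ (n + 1) : ℕ) := by simp [pow_succ]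
    rw [← htotal] at h2
    exact absurd (hrest.one_add) (Nat.not_odd_iff_even.2 h2)
  have hlead' : ∀ k, ∃ c ∈ s P', IsLeading v c k := by
    by_contra h
    exact absurd hodd (Nat.not_odd_iff_even.2 (heven P' hPT' h))
  obtain ⟨ε, hε⟩ := Finset.card_pos.1 hodd.pos
  simp only [Finset.mem_filter, Finset.mem_univ, true_and] at hε
  -- A constraint either leads at `0`, with sign `ε 0`, or vanishes at `x`; hence `ε 0 • x` lies in
  -- `P'`.
  have hsign : ∀ c ∈ s P',
      0 ≤ ((ε 0 : ℤ) : ℝ) * ⟪c, (x : EuclideanSpace ℝ (Fin (n + 1)))⟫ := by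
    intro c hc
    obtain ⟨k, h0, hk⟩ := hε c hc
    rcases eq_or_ne k 0 with rfl | hk0
    · rw [← hvx]
      exact hk.le
    · rw [← hvx, h0 0 (Fin.pos_of_ne_zero hk0), mul_zero]
  rcases Int.units_eq_one_or (ε 0) with h1 | h1
  · refine Or.inl (isVertex_of_isLeading (hs P' hPT').2 hvx hlead' ?_ (Or.inl rfl))
    rw [(hs P' hPT').2]
    intro c hc
    simpa [h1] using hsign c hc
  · refine Or.inr (isVertex_of_isLeading (hs P' hPT').2 hvx hlead' ?_ (Or.inr rfl))
    rw [(hs P' hPT').2]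
    intro c hc
    simpa [h1] using hsign c hc

end UnitSphere

theorem mainTheorem7 (n : ℕ) (T : Set (Set (UnitSphere n)))
    (hT : UnitSphere.IsLocallyFiniteTiling T)
    (P P' : Set (UnitSphere n)) (hne : P ≠ P')
    (hA : {Q ∈ T | UnitSphere.IsAType Q} = {P, P'})
    (x : UnitSphere n) (hx : UnitSphere.IsVertex x P) :
    Xor (UnitSphere.IsVertex x P') (UnitSphere.IsVertex (-x) P') := by
  have hA' : UnitSphere.IsAType P' := by
    have : P' ∈ {Q ∈ T | UnitSphere.IsAType Q} := by simp [hA]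
    exact this.2
  have hnot : ¬ (UnitSphere.IsVertex x P' ∧ UnitSphere.IsVertex (-x) P') := fun h =>
    hA' ⟨x, h.1.mem, h.2.mem⟩
  rcases UnitSphere.isVertex_or_isVertex_neg hT hA hx with h | h
  · exact Or.inl ⟨h, fun h' => hnot ⟨h, h'⟩⟩
  · exact Or.inr ⟨h, fun h' => hnot ⟨h', h⟩⟩
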